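/- Let $K$ be a field of characteristic not $2$ (finite or infinite), let $n,d\ge 0$ be integers, let $\lambda$ be a partition of $n$ with Young diagram $[\lambda]$, let $E=K^d$ be the natural left $K\mathrm{GL}_d(K)$-module with its canonical basis, and let $W=K^n$ be the natural permutation module of the symmetric group $S_n$ with its permutation basis. For a left module $V$ over a group algebra $KG$ with a chosen basis $\mathcal B$, let $T^\lambda(V)$ be the space with basis the tableaux $t\colon[\lambda]\to\mathcal B$, that is, the tensor power of $V$ indexed by the boxes of $[\lambda]$, with the diagonal $G$-action and the place-permutation action $(t\cdot\sigma)(b)=t(\sigma^{-1}b)$ of the permutations $\sigma$ of $[\lambda]$. Let $\mathrm{Sym}^\lambda V$ be the quotient of $T^\lambda(V)$ by the span of all $x\cdot\sigma-x$ with $x\in T^\lambda(V)$ and $\sigma$ preserving each row, and write $\{t\}$ for the image of $t$. The polytabloid of $t$ is $e(t)=\sum_{\sigma}\operatorname{sgn}(\sigma)\{t\cdot\sigma\}\in\mathrm{Sym}^\lambda V$, the sum being over the permutations $\sigma$ of $[\lambda]$ that preserve each column. Let $\nabla^\lambda(V)\subseteq\mathrm{Sym}^\lambda V$ be the $KG$-submodule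 spanned by all polytabloids. The dual Weyl module is $\nabla^\lambda(E)$. The Specht module $S^\lambda\subseteq\mathrm{Sym}^\lambda W$ is the $KS_n$-submodule spanned by the polytabloids of the tableaux whose entries are distinct elements of the permutation basis of $W$. Regard $E^{\otimes n}$ as a right $KS_n$-module by place permutation, with $\mathrm{GL}_d(K)$ acting diagonally on the left. Then there is an isomorphism of left $K\mathrm{GL}_d(K)$-modules $$\mathcal G_\otimes(S^\lambda)=E^{\otimes n}\otimes_{KS_n}S^\lambda\;\cong\;\nabla^\lambda(E).$$ -/

import Mathlib

noncomputable section

namespace InverseSchur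

open scoped TensorProduct

/-- The Young diagram of a partition of `n`: row `i` (counted from `0`) consists of the boxes
`(i, j)` with `j` less than the `i`-th largest part. -/
def diagram {n : ℕ} (p : n.Partition) : YoungDiagram :=
  YoungDiagram.ofRowLens (p.parts.sort (· ≥ ·)) (p.parts.pairwise_sort (· ≥ ·)).sortedGE

/-- The boxes of a Young diagram, as pairs (row, column). -/
abbrev Box (μ : YoungDiagram) : Type := {c : ℕ × ℕ // c ∈ μ.cells}

/-- Row-preserving place permutations. -/
def rowPerms (μ : YoungDiagram) : Subgroup (Equiv.Perm (Box μ)) where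
  carrier := {s | ∀ c, (s c).1.1 = c.1.1}
  one_mem' := fun _ => rfl
  mul_mem' := fun {s t} hs ht c => (hs (t c)).trans (ht c)
  inv_mem' := fun {s} hs c => by simpa using (hs (s⁻¹ c)).symm

/-- Column-preserving place permutations. -/
def colPerms (μ : YoungDiagram) : Subgroup (Equiv.Perm (Box μ)) where
  carrier := {s | ∀ c, (s c).1.2 = c.1.2}
  one_mem' := fun _ => rfl
  mul_mem' := fun {s t} hs ht c => (hs (t c)).trans (ht c)
  inv_mem' := fun {s} hs c => by simpa using (hs (s⁻¹ c)).symm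

instance (μ : YoungDiagram) : DecidablePred (· ∈ colPerms μ) := fun s =>
  inferInstanceAs (Decidable (∀ c, (s c).1.2 = c.1.2))

section Tensor

variable (K : Type*) [Field K] (X : Type*) (V : Type*) [AddCommGroup V] [Module K V]

/-- The place permutation of a tensor: the factor of `placePerm K X V s x` in place `c` is the
factor of `x` in place `s⁻¹ c`. -/
def placePerm (s : Equiv.Perm X) : (⨂[K] _ : X, V) →ₗ[K] (⨂[K] _ : X, V) :=
  (PiTensorProduct.reindex K (fun _ : X => V) s).toLinearMap

variable {K V} in
theorem placePerm_tprod (s : Equiv.Perm X) (f : X → V) :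
    placePerm K X V s (PiTensorProduct.tprod K f) =
      PiTensorProduct.tprod K (fun c => f (s⁻¹ c)) :=
  PiTensorProduct.reindex_tprod (R := K) (s := fun _ : X => V) s f

variable {K V} {G : Type*} [Monoid G]

/-- The diagonal action of `G` on a tensor power of a representation. -/
def diagRep (ρ : Representation K G V) : Representation K G (⨂[K] _ : X, V) where
  toFun g := PiTensorProduct.map (fun _ => ρ g)
  map_one' := by
    rw [map_one]
    exact PiTensorProduct.map_one
  map_mul' g h := by
    rw [map_mul]
    exact PiTensorProduct.map_mul (fun _ => ρ g) (fun _ => ρ h)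

theorem diagRep_tprod (ρ : Representation K G V) (g : G) (f : X → V) :
    diagRep X ρ g (PiTensorProduct.tprod K f) = PiTensorProduct.tprod K (fun c => ρ g (f c)) :=
  PiTensorProduct.map_tprod _ _

theorem diagRep_placePerm (ρ : Representation K G V) (g : G) (s : Equiv.Perm X)
    (x : ⨂[K] _ : X, V) :
    diagRep X ρ g (placePerm K X V s x) = placePerm K X V s (diagRep X ρ g x) := by
  have h : (diagRep X ρ g) ∘ₗ (placePerm K X V s) = (placePerm K X V s) ∘ₗ (diagRep X ρ g) := by
    ext f
    simp only [LinearMap.compMultilinearMap_apply, LinearMap.comp_apply, placePerm_tprod,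
      diagRep_tprod]
  exact LinearMap.congr_fun h x

end Tensor

section Polytabloids

variable (K : Type*) [Field K] (μ : YoungDiagram) (V : Type*) [AddCommGroup V] [Module K V]

/-- The space with basis the tableaux of shape `μ` with entries in a basis of `V`, in the
basis-free form of the tensor power of `V` indexed by the boxes of `μ`. -/
abbrev TabSpace : Type _ := ⨂[K] _ : Box μ, V

/-- The span of all `x · s - x` with `s` a row-preserving place permutation. -/
def symRel : Submodule K (TabSpace K μ V) :=
  Submodule.span K {y | ∃ x : TabSpace K μ V, ∃ s ∈ rowPerms μ, y = placePerm K (Box μ) V s x - x}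

/-- The space of row tabloids of shape `μ`. -/
abbrev RowTabloids : Type _ := TabSpace K μ V ⧸ symRel K μ V

/-- The linear map sending a tableau to its polytabloid: the signed sum, over the
column-preserving place permutations `s`, of the row tabloids of `t · s`. -/
def polytabloid : TabSpace K μ V →ₗ[K] RowTabloids K μ V :=
  ∑ s : colPerms μ, (((Equiv.Perm.sign s.1 : ℤˣ) : ℤ) : K) •
    ((symRel K μ V).mkQ ∘ₗ placePerm K (Box μ) V s.1)

variable {K V} {ι : Type*} (b : Module.Basis ι K V)

/-- The element of the space of tableaux given by a tableau `t` with entries in the basis `b`. -/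
def tabVec (t : Box μ → ι) : TabSpace K μ V := PiTensorProduct.tprod K (fun c => b (t c))

/-- The span of the polytabloids of all tableaux of shape `μ` with entries in the basis `b`. -/
def nabla : Submodule K (RowTabloids K μ V) :=
  Submodule.span K (Set.range fun t : Box μ → ι => polytabloid K μ V (tabVec μ b t))

/-- The span of the polytabloids of the tableaux of symmetric type (those with distinct
entries). -/
def nablaSym : Submodule K (RowTabloids K μ V) :=
  Submodule.span K {y | ∃ t : Box μ → ι, Function.Injective t ∧
    y = polytabloid K μ V (tabVec μ b t)}

variable {G : Type*} [Monoid G] (ρ : Representation K G V)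

theorem symRel_le_comap (g : G) :
    symRel K μ V ≤ (symRel K μ V).comap (diagRep (Box μ) ρ g) := by
  refine Submodule.span_le.2 ?_
  rintro y ⟨x, s, hs, rfl⟩
  refine Submodule.subset_span ⟨diagRep (Box μ) ρ g x, s, hs, ?_⟩
  rw [map_sub, diagRep_placePerm]

/-- The diagonal action on row tabloids. -/
def rowTabloidsRep : Representation K G (RowTabloids K μ V) :=
  (diagRep (Box μ) ρ).quotient (symRel K μ V) (symRel_le_comap μ ρ)

theorem rowTabloidsRep_polytabloid (g : G) (x : TabSpace K μ V) :
    rowTabloidsRep μ ρ g (polytabloid K μ V x) =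
      polytabloid K μ V (diagRep (Box μ) ρ g x) := by
  rw [polytabloid, LinearMap.sum_apply, LinearMap.sum_apply, map_sum]
  refine Finset.sum_congr rfl fun s _ => ?_
  rw [LinearMap.smul_apply, LinearMap.smul_apply, map_smul, LinearMap.comp_apply,
    LinearMap.comp_apply, ← diagRep_placePerm]
  rfl

theorem nabla_eq_range : nabla μ b = LinearMap.range (polytabloid K μ V) := by
  have h : Submodule.span K (Set.range (tabVec μ b)) = ⊤ := by
    have h1 := (Basis.piTensorProduct (fun _ : Box μ => b)).span_eq
    rw [← h1]
    congr 2
    ext t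
    exact (Basis.piTensorProduct_apply (fun _ : Box μ => b) t).symm
  rw [nabla, LinearMap.range_eq_map, ← h, Submodule.map_span, ← Set.range_comp]
  rfl

theorem nabla_le_comap (g : G) : nabla μ b ≤ (nabla μ b).comap (rowTabloidsRep μ ρ g) := by
  rw [nabla_eq_range]
  rintro _ ⟨x, rfl⟩
  exact ⟨diagRep (Box μ) ρ g x, (rowTabloidsRep_polytabloid μ ρ g x).symm⟩

/-- The space of polytabloids as a representation of `G`. -/
def nablaRep : Representation K G (nabla μ b) :=
  (rowTabloidsRep μ ρ).subrepresentation (nabla μ b) (nabla_le_comap μ b ρ)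

end Polytabloids

section Specht

variable (K : Type*) [Field K] (n : ℕ)

/-- The natural permutation representation of the symmetric group: `g` sends the `i`-th basis
vector to the `g i`-th one. -/
def permRep : Representation K (Equiv.Perm (Fin n)) (Fin n →₀ K) where
  toFun g := Finsupp.lmapDomain K K g
  map_one' := Finsupp.lmapDomain_id K K
  map_mul' g h := Finsupp.lmapDomain_comp K K h g

/-- The canonical basis of the natural permutation module. -/
abbrev permBasis : Module.Basis (Fin n) K (Fin n →₀ K) := Finsupp.basisSingleOne

variable (μ : YoungDiagram)

/-- The Specht module: the space of polytabloids of symmetric type in the natural permutation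
module. -/
abbrev Specht : Submodule K (RowTabloids K μ (Fin n →₀ K)) := nablaSym μ (permBasis K n)

theorem specht_le_comap (g : Equiv.Perm (Fin n)) :
    Specht K n μ ≤ (Specht K n μ).comap (rowTabloidsRep μ (permRep K n) g) := by
  refine Submodule.span_le.2 ?_
  rintro _ ⟨t, ht, rfl⟩
  refine Submodule.subset_span ⟨g ∘ t, g.injective.comp ht, ?_⟩
  rw [rowTabloidsRep_polytabloid]
  congr 1
  rw [tabVec, diagRep_tprod]
  congr 1
  funext c
  simp only [permBasis, Finsupp.coe_basisSingleOne]
  exact Finsupp.mapDomain_single (f := g) (a := t c) (b := (1 : K))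

/-- The action of the symmetric group on the Specht module. -/
def spechtRep : Representation K (Equiv.Perm (Fin n)) (Specht K n μ) :=
  (rowTabloidsRep μ (permRep K n)).subrepresentation (Specht K n μ) (specht_le_comap K n μ)

end Specht

section Balanced

variable {K : Type*} [Field K] {S : Type*} [Group S]
  {M : Type*} [AddCommGroup M] [Module K M] {U : Type*} [AddCommGroup U] [Module K U]
  (r : Representation K Sᵐᵒᵖ M) (σ : Representation K S U)

/-- The relations `x s ⊗ u = x ⊗ s u`. It is enough to take `s` in the group `S`, since both sides
are linear in `s`. -/
def balancedRel : Submodule K (M ⊗[K] U) :=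
  Submodule.span K {y | ∃ (s : S) (x : M) (u : U),
    y = (r (MulOpposite.op s) x) ⊗ₜ[K] u - x ⊗ₜ[K] (σ s u)}

/-- The tensor product `M ⊗_{KS} U` of a right and a left module over the group algebra `KS`. -/
abbrev BalancedTensor : Type _ := (M ⊗[K] U) ⧸ balancedRel r σ

end Balanced

section InverseSchurFunctor

variable (K : Type*) [Field K] (n d : ℕ)

/-- The natural module of `GL_d(K)`. -/
def natRep : Representation K (GL (Fin d) K) (Fin d → K) where
  toFun g := Matrix.toLin' (g : Matrix (Fin d) (Fin d) K)
  map_one' := by simp; rfl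
  map_mul' g h := by simp [Matrix.toLin'_mul]; rfl

/-- The right action of the symmetric group on `E^{⊗ n}` by place permutation: the `i`-th factor
of `x s` is the `s i`-th factor of `x`. -/
def placeRep (V : Type*) [AddCommGroup V] [Module K V] :
    Representation K (Equiv.Perm (Fin n))ᵐᵒᵖ (⨂[K] _ : Fin n, V) where
  toFun s := placePerm K (Fin n) V (s.unop)⁻¹
  map_one' := by
    ext f
    simp only [LinearMap.compMultilinearMap_apply, placePerm_tprod]
    rfl
  map_mul' s t := by
    ext f
    simp only [LinearMap.compMultilinearMap_apply, Module.End.mul_apply, placePerm_tprod]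
    rfl

variable {n} {U : Type*} [AddCommGroup U] [Module K U]
  (σ : Representation K (Equiv.Perm (Fin n)) U)

/-- The underlying space `E^{⊗ n} ⊗_{K S_n} U` of the image of `U` under the inverse Schur
functor. -/
abbrev GTensor : Type _ := BalancedTensor (placeRep K n (Fin d → K)) σ

theorem balancedRel_le_comap (g : GL (Fin d) K) :
    balancedRel (placeRep K n (Fin d → K)) σ ≤
      (balancedRel (placeRep K n (Fin d → K)) σ).comap
        (TensorProduct.map (diagRep (Fin n) (natRep K d) g) LinearMap.id) := by
  refine Submodule.span_le.2 ?_
  rintro _ ⟨s, x, u, rfl⟩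
  refine Submodule.subset_span ⟨s, diagRep (Fin n) (natRep K d) g x, u, ?_⟩
  simp [placeRep, diagRep_placePerm]

/-- The action of `GL_d(K)` on `E^{⊗ n} ⊗_{K S_n} U`, through the diagonal action on
`E^{⊗ n}`. -/
def gTensorRep : Representation K (GL (Fin d) K) (GTensor K d σ) where
  toFun g := Submodule.mapQ _ _
    (TensorProduct.map (diagRep (Fin n) (natRep K d) g) LinearMap.id)
    (balancedRel_le_comap K d σ g)
  map_one' := by
    ext x
    simp
  map_mul' g h := by
    ext x
    simp

/-- The dual Weyl module of `GL_d(K)` labelled by `μ`. -/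
abbrev dualWeylRep (μ : YoungDiagram) :
    Representation K (GL (Fin d) K) (nabla μ (Pi.basisFun K (Fin d))) :=
  nablaRep μ (Pi.basisFun K (Fin d)) (natRep K d)

end InverseSchurFunctor

end InverseSchur

end

namespace InverseSchur

/-! Substituting the factors of a tensor for the entries of a tableau gives a linear map
`fromGTensor` from `E^{⊗ n} ⊗ S^μ` to the row tabloids of `E`. In the other direction, a numbering
`e` of the boxes gives `toGTensor`, which pairs a tensor with the polytabloid of `e`. It is onto
because that polytabloid generates the Specht module, and `fromGTensor ∘ toGTensor` is the
polytabloid map. Hence the image of `fromGTensor` is the dual Weyl module, and what remains is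
injectivity: `toGTensor` must kill everything that the polytabloid map kills.

For this, every linear relation among place permutations that holds for polytabloids over `K^n` also
holds for `toGTensor` (`sum_smul_toGTensor_placePerm`). The column swap and Garnir relations are of
this kind, and they suffice to straighten any tableau into semistandard ones modulo the kernel of
`toGTensor` (`span_semistandard_sup_ker`). Semistandard polytabloids are linearly independent
(`linearIndependent_polytabloid`), so no further relations exist. Characteristic 2 is excluded
because a tableau with a repeated entry in a column is only seen to satisfy `2 φ(t) = 0`. -/

theorem card_cellsOfRowLens (w : List ℕ) : (YoungDiagram.cellsOfRowLens w).card = w.sum := by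
  induction w with
  | nil => rfl
  | cons a w ih =>
    rw [YoungDiagram.cellsOfRowLens, Finset.card_union_of_disjoint]
    · simp [ih]
    · rw [Finset.disjoint_left]
      rintro ⟨i, j⟩ h h'
      simp only [Finset.mem_product, Finset.mem_singleton] at h
      simp [h.1] at h'

theorem card_box_diagram {n : ℕ} (p : n.Partition) : Fintype.card (Box (diagram p)) = n := by
  rw [Fintype.card_coe]
  refine (card_cellsOfRowLens _).trans ?_
  rw [← Multiset.sum_coe, Multiset.sort_eq, p.parts_sum]

/-! ### Combinatorics of tableaux: weights, column strictness, row contents. -/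

variable {μ : YoungDiagram} {d : ℕ}

/-- A tableau all of whose columns are strictly increasing. -/
def ColStrict (t : Box μ → Fin d) : Prop :=
  ∀ c c' : Box μ, c.1.2 = c'.1.2 → c.1.1 < c'.1.1 → t c < t c'

/-- A semistandard tableau: strictly increasing columns, weakly increasing rows. -/
def Semistandard (t : Box μ → Fin d) : Prop :=
  ColStrict t ∧ ∀ c c' : Box μ, c.1.1 = c'.1.1 → c.1.2 < c'.1.2 → t c ≤ t c'

/-- The sum of the entries of a tableau, weighted by `f`. -/
def weight (f : Box μ → ℕ) (t : Box μ → Fin d) : ℕ := ∑ c, f c * (t c : ℕ)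

theorem weight_comp_perm (f : Box μ → ℕ) (t : Box μ → Fin d) (s : Equiv.Perm (Box μ)) :
    weight f (t ∘ s) = weight (f ∘ ⇑s⁻¹) t := by
  unfold weight
  rw [← Equiv.sum_comp s (fun c => (f ∘ ⇑s⁻¹) c * (t c : ℕ))]
  simp

/-- Moving the entries above a threshold to places of larger weight increases the weight. -/
theorem weight_lt_weight_comp {f : Box μ → ℕ} {t : Box μ → Fin d} {s : Equiv.Perm (Box μ)}
    (θ : Fin d) (h : ∀ c, 0 ≤ ((f (s c) : ℤ) - f c) * ((t c : ℤ) - θ))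
    (h' : ∃ c, 0 < ((f (s c) : ℤ) - f c) * ((t c : ℤ) - θ)) :
    weight f t < weight f (t ∘ ⇑s⁻¹) := by
  rw [weight_comp_perm, inv_inv]
  have h0 : 0 < ∑ c, ((f (s c) : ℤ) - f c) * ((t c : ℤ) - θ) := by
    obtain ⟨c, hc⟩ := h'
    exact Finset.sum_pos' (fun c _ => h c) ⟨c, Finset.mem_univ c, hc⟩
  -- A permutation does not change the total of `f`, so subtracting the threshold `θ` from every
  -- entry leaves the weight difference unchanged.
  have h1 : ∑ c, (f (s c) : ℤ) = ∑ c, (f c : ℤ) := Equiv.sum_comp s (fun c => (f c : ℤ))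
  have h2 : ∑ c, ((f (s c) : ℤ) - f c) * ((t c : ℤ) - θ) =
      (∑ c, (f (s c) : ℤ) * t c - ∑ c, (f c : ℤ) * t c) -
        (∑ c, (f (s c) : ℤ) - ∑ c, (f c : ℤ)) * θ := by
    rw [← Finset.sum_sub_distrib, ← Finset.sum_sub_distrib, Finset.sum_mul,
      ← Finset.sum_sub_distrib]
    exact Finset.sum_congr rfl fun c _ => by ring
  rw [h2, h1, sub_self, zero_mul, sub_zero, sub_pos] at h0
  unfold weight
  exact_mod_cast h0

/-- The row index of a box. -/
def rowIdx (c : Box μ) : ℕ := c.1.1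

/-- The column index of a box. -/
def colIdx (c : Box μ) : ℕ := c.1.2

theorem rowIdx_lt (c : Box μ) : rowIdx c < μ.colLen (colIdx c) :=
  YoungDiagram.mem_iff_lt_colLen.1 c.2

/-- A permutation that reflects a linear order induced from the natural numbers is trivial. -/
theorem eq_one_of_reflects_lt {α : Type*} {F : α → ℕ} (hF : Function.Injective F)
    {s : Equiv.Perm α} (h : ∀ c c', F (s c) < F (s c') → F c < F c') : s = 1 := by
  refine Equiv.ext fun c => ?_
  induction hc : F c using Nat.strong_induction_on generalizing c with
  | _ m ih =>
    subst hc
    rcases lt_trichotomy (F (s c)) (F c) with hlt | heq | hlt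
    · exact s.injective (ih _ hlt (s c) rfl)
    · exact hF heq
    · have h1 : F (s⁻¹ c) < F c := h _ _ (by simpa using hlt)
      have h2 : c = s⁻¹ c := by simpa using ih _ h1 (s⁻¹ c) rfl
      exact absurd h1 (by rw [← h2]; exact lt_irrefl _)

/-- In a tableau with strictly increasing columns, every nontrivial column permutation lowers the
sum of the entries weighted by their rows. -/
theorem ColStrict.eq_one_of_weight_le {t : Box μ → Fin d} (ht : ColStrict t)
    {s : Equiv.Perm (Box μ)} (hs : s ∈ colPerms μ)
    (h : weight rowIdx t ≤ weight rowIdx (t ∘ s)) : s = 1 := by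
  -- `F` lists the boxes column by column, from top to bottom; `N` exceeds every row index. `G`
  -- induces the same order through the entries, since columns increase strictly and entries are
  -- below `d`. The rearrangement inequality is then applied to `F` and `G`.
  let N := μ.colLen 0
  let F : Box μ → ℕ := fun c => rowIdx c + N * colIdx c
  let G : Box μ → ℕ := fun c => t c + d * colIdx c
  have hs' : ∀ c, colIdx (s c) = colIdx c := hs
  have hN : ∀ c : Box μ, rowIdx c < N := fun c =>
    (rowIdx_lt c).trans_le (μ.colLen_anti _ _ (Nat.zero_le _))
  have hF : ∀ c c' : Box μ, F c < F c' ↔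
      colIdx c < colIdx c' ∨ colIdx c = colIdx c' ∧ rowIdx c < rowIdx c' := by
    intro c c'
    have h1 := hN c
    have h2 := hN c'
    rcases lt_trichotomy (colIdx c) (colIdx c') with h | h | h
    · have := Nat.mul_le_mul_left N (Nat.succ_le_of_lt h)
      simp only [F, h, true_or, iff_true]
      rw [Nat.mul_succ] at this
      omega
    · simp [F, h]
    · have := Nat.mul_le_mul_left N (Nat.succ_le_of_lt h)
      rw [Nat.mul_succ] at this
      simp only [F, h.not_gt, h.ne', false_and, or_false, iff_false]
      omega
  have hG : ∀ c c' : Box μ, G c < G c' ↔ F c < F c' := by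
    intro c c'
    rw [hF]
    have h1 := (t c).2
    have h2 := (t c').2
    rcases lt_trichotomy (colIdx c) (colIdx c') with h | h | h
    · have := Nat.mul_le_mul_left d (Nat.succ_le_of_lt h)
      simp only [G, h, true_or, iff_true]
      rw [Nat.mul_succ] at this
      omega
    · simp only [G, h, lt_irrefl, true_and, false_or, Nat.add_lt_add_iff_right]
      refine ⟨fun hlt => ?_, fun hlt => ht c c' h hlt⟩
      by_contra! hle
      rcases hle.lt_or_eq with hle | hle
      · exact absurd (ht c' c h.symm hle) (not_lt.2 hlt.le)
      · have : c = c' := Subtype.ext (Prod.ext hle.symm h)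
        simp [this] at hlt
    · have := Nat.mul_le_mul_left d (Nat.succ_le_of_lt h)
      rw [Nat.mul_succ] at this
      simp only [G, h.not_gt, h.ne', false_and, or_false, iff_false]
      omega
  have hmono : Monovary F G := fun c c' hc => ((hG c c').1 hc).le
  have hsum : ∑ c, F c * G (s c) = ∑ c, F c * G c := by
    refine le_antisymm hmono.sum_mul_comp_perm_le_sum_mul ?_
    -- As `s` preserves columns, `∑ F * G` and `∑ F * (G ∘ s)` differ only in their row weights,
    -- which `h` compares. This forces equality in the rearrangement inequality, whose equality case
    -- shows that `s` reflects the order given by `F`.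
    have e1 : ∑ c, colIdx c * (t (s c) : ℕ) = ∑ c, colIdx c * (t c : ℕ) := by
      rw [← Equiv.sum_comp s (fun c => colIdx c * (t c : ℕ))]
      simp only [hs']
    have e2 : ∀ u : Box μ → Fin d, ∑ c, F c * (u c + d * colIdx c) =
        weight rowIdx u + N * ∑ c, colIdx c * (u c : ℕ) + ∑ c, F c * (d * colIdx c) := by
      intro u
      rw [weight, Finset.mul_sum, ← Finset.sum_add_distrib, ← Finset.sum_add_distrib]
      exact Finset.sum_congr rfl fun c _ => by simp only [F]; ring
    have e3 := e2 t
    have e4 := e2 (t ∘ s)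
    simp only [Function.comp_apply, e1] at e4
    simp only [G, hs']
    rw [e3, e4]
    exact Nat.add_le_add_right (Nat.add_le_add_right h _) _
  have hmono' : Monovary F (G ∘ s) := hmono.sum_mul_comp_perm_eq_sum_mul_iff.1 hsum
  have hFinj : Function.Injective F := by
    intro c c' hc
    have h1 := (hF c c').not.1 hc.not_lt
    have h2 := (hF c' c).not.1 hc.not_gt
    refine Subtype.ext (Prod.ext ?_ ?_) <;> simp only [rowIdx, colIdx] at h1 h2 <;> omega
  have hle : ∀ c c', F (s c) < F (s c') → F c < F c' := fun c c' h =>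
    lt_of_le_of_ne (hmono' ((hG _ _).2 h)) fun h' => by simp [hFinj h'] at h
  exact eq_one_of_reflects_lt hFinj hle

/-- The row content of a tableau: the multiset of pairs (row, entry). -/
def rowContent (t : Box μ → Fin d) : Multiset (ℕ × Fin d) :=
  Finset.univ.val.map fun c => (rowIdx c, t c)

theorem rowContent_comp_of_mem_rowPerms (t : Box μ → Fin d) {s : Equiv.Perm (Box μ)}
    (hs : s ∈ rowPerms μ) : rowContent (t ∘ s) = rowContent t := by
  have hs' : ∀ c, rowIdx (s c) = rowIdx c := hs
  have h : (fun c => (rowIdx c, (t ∘ s) c)) = (fun c => (rowIdx c, t c)) ∘ s := by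
    funext c
    simp [hs']
  rw [rowContent, h, ← Multiset.map_map, Multiset.map_univ_val_equiv, rowContent]

theorem weight_rowIdx_eq (t : Box μ → Fin d) :
    weight rowIdx t = ((rowContent t).map fun q => q.1 * (q.2 : ℕ)).sum := by
  simp [rowContent, weight, Multiset.map_map, Finset.sum]

/-- Count the entries at most `t c` in the row of `c`. If `t c < u c`, those of `u` lie strictly to
the left of `c`, where `t` is also at most `t c`; the box `c` itself is one more for `t`, against
equality of the row contents. -/
theorem Semistandard.le_of_rowContent_eq {t u : Box μ → Fin d} (ht : Semistandard t)
    (hu : Semistandard u) (h : rowContent t = rowContent u) (c : Box μ) : u c ≤ t c := by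
  by_contra! hlt
  have hcard : ∀ v : Box μ → Fin d, (rowContent v).countP (fun q => q.1 = rowIdx c ∧ q.2 ≤ t c) =
      (Finset.univ.filter fun x => rowIdx x = rowIdx c ∧ v x ≤ t c).card := by
    intro v
    rw [rowContent, Multiset.countP_map]
    rfl
  have heq := (hcard t).symm.trans ((congrArg _ h).trans (hcard u))
  refine absurd heq (ne_of_gt (Finset.card_lt_card (Finset.ssubset_iff_subset_ne.2 ⟨?_, ?_⟩)))
  · intro x
    simp only [Finset.mem_filter, Finset.mem_univ, true_and]
    rintro ⟨hx, hx'⟩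
    refine ⟨hx, ?_⟩
    have hcol : colIdx x < colIdx c := by
      by_contra! hle
      rcases hle.lt_or_eq with hle | hle
      · exact absurd (hu.2 c x hx.symm hle) (not_le.2 (hx'.trans_lt hlt))
      · have : c = x := Subtype.ext (Prod.ext hx.symm hle)
        exact absurd hx' (not_le.2 (this ▸ hlt))
    exact ht.2 x c hx hcol
  · intro hset
    have hc : c ∈ Finset.univ.filter fun x => rowIdx x = rowIdx c ∧ t x ≤ t c := by simp
    rw [← hset] at hc
    simp only [Finset.mem_filter, Finset.mem_univ, true_and] at hc
    exact absurd hc (not_le.2 hlt)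

theorem Semistandard.eq_of_rowContent_eq {t u : Box μ → Fin d} (ht : Semistandard t)
    (hu : Semistandard u) (h : rowContent t = rowContent u) : t = u :=
  funext fun c => le_antisymm (hu.le_of_rowContent_eq ht h.symm c) (ht.le_of_rowContent_eq hu h c)

end InverseSchur

noncomputable section
namespace InverseSchur
open scoped TensorProduct

/-! ### Place permutations, signs and the column swap relation. -/

section PlacePermutations

variable {K : Type*} [Field K] {X : Type*} {V : Type*} [AddCommGroup V] [Module K V]

theorem placePerm_mul (s t : Equiv.Perm X) (x : ⨂[K] _ : X, V) :
    placePerm K X V (s * t) x = placePerm K X V s (placePerm K X V t x) := by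
  have h : placePerm K X V (s * t) = placePerm K X V s ∘ₗ placePerm K X V t := by
    ext f
    simp only [LinearMap.compMultilinearMap_apply, LinearMap.comp_apply, placePerm_tprod]
    rfl
  exact LinearMap.congr_fun h x

theorem placePerm_one (x : ⨂[K] _ : X, V) : placePerm K X V 1 x = x := by
  have h : placePerm K X V 1 = LinearMap.id := by
    ext f
    simp only [LinearMap.compMultilinearMap_apply, placePerm_tprod]
    rfl
  exact LinearMap.congr_fun h x

end PlacePermutations

/-- The sign of a permutation as a scalar. -/
def signScalar (K : Type*) [Field K] {X : Type*} [Fintype X] [DecidableEq X]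
    (s : Equiv.Perm X) : K :=
  ((Equiv.Perm.sign s : ℤˣ) : ℤ)

theorem signScalar_mul (K : Type*) [Field K] {X : Type*} [Fintype X] [DecidableEq X]
    (s t : Equiv.Perm X) : signScalar K (s * t) = signScalar K s * signScalar K t := by
  simp [signScalar]

theorem signScalar_swap (K : Type*) [Field K] {X : Type*} [Fintype X] [DecidableEq X]
    {a b : X} (h : a ≠ b) : signScalar K (Equiv.swap a b) = -1 := by
  simp [signScalar, Equiv.Perm.sign_swap h]

theorem signScalar_one (K : Type*) [Field K] {X : Type*} [Fintype X] [DecidableEq X] :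
    signScalar K (1 : Equiv.Perm X) = 1 := by
  simp [signScalar]

variable {K : Type*} [Field K] {μ : YoungDiagram} {V : Type*} [AddCommGroup V] [Module K V]

theorem polytabloid_apply (x : TabSpace K μ V) :
    polytabloid K μ V x = ∑ s : colPerms μ, signScalar K s.1 •
      (symRel K μ V).mkQ (placePerm K (Box μ) V s.1 x) := by
  rw [polytabloid, LinearMap.sum_apply]
  rfl

theorem mkQ_placePerm {s : Equiv.Perm (Box μ)} (hs : s ∈ rowPerms μ) (x : TabSpace K μ V) :
    (symRel K μ V).mkQ (placePerm K (Box μ) V s x) = (symRel K μ V).mkQ x := by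
  rw [← sub_eq_zero, ← map_sub, Submodule.mkQ_apply, Submodule.Quotient.mk_eq_zero]
  exact Submodule.subset_span ⟨x, s, hs, rfl⟩

theorem swap_mem_colPerms {a b : Box μ} (h : colIdx a = colIdx b) :
    Equiv.swap a b ∈ colPerms μ := by
  intro c
  change colIdx _ = colIdx c
  rw [Equiv.swap_apply_def]
  split_ifs with h1 h2 <;> simp [*]

theorem swap_mem_rowPerms {a b : Box μ} (h : rowIdx a = rowIdx b) :
    Equiv.swap a b ∈ rowPerms μ := by
  intro c
  change rowIdx _ = rowIdx c
  rw [Equiv.swap_apply_def]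
  split_ifs with h1 h2 <;> simp [*]

theorem polytabloid_placePerm_swap {a b : Box μ} (hab : a ≠ b) (h : colIdx a = colIdx b)
    (x : TabSpace K μ V) :
    polytabloid K μ V (placePerm K (Box μ) V (Equiv.swap a b) x) = -polytabloid K μ V x := by
  rw [polytabloid_apply, polytabloid_apply, ← Finset.sum_neg_distrib,
    ← Equiv.sum_comp (Equiv.mulRight (⟨Equiv.swap a b, swap_mem_colPerms h⟩ : colPerms μ))]
  refine Finset.sum_congr rfl fun s _ => ?_
  simp only [Equiv.coe_mulRight, Subgroup.coe_mul, signScalar_mul, signScalar_swap K hab,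
    ← placePerm_mul, mul_assoc, Equiv.swap_mul_self, mul_one, mul_neg, neg_smul]

/-! ### Garnir relations. -/

section Garnir

open Classical in
/-- The products of a column permutation and a permutation supported on `A`. -/
def garnirSet (A : Set (Box μ)) : Finset (Equiv.Perm (Box μ)) :=
  Finset.univ.filter fun g => ∃ c ∈ colPerms μ, ∃ h : Equiv.Perm (Box μ),
    (∀ x, x ∉ A → h x = x) ∧ g = c * h

theorem mem_garnirSet {A : Set (Box μ)} {g : Equiv.Perm (Box μ)} :
    g ∈ garnirSet A ↔ ∃ c ∈ colPerms μ, ∃ h : Equiv.Perm (Box μ),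
      (∀ x, x ∉ A → h x = x) ∧ g = c * h := by
  simp [garnirSet]

theorem image_eq_of_support {A : Set (Box μ)} {h : Equiv.Perm (Box μ)}
    (hh : ∀ x, x ∉ A → h x = x) : h '' A = A := by
  have h1 : ∀ x, h x ∈ A ↔ x ∈ A := by
    intro x
    constructor
    · intro hx
      by_contra hx'
      exact hx' (hh x hx' ▸ hx)
    · intro hx
      by_contra hx'
      exact hx' ((h.injective (hh _ hx')).symm ▸ hx)
  ext y
  constructor
  · rintro ⟨x, hx, rfl⟩
    exact (h1 x).2 hx
  · intro hy
    exact ⟨h⁻¹ y, (h1 _).1 (by simpa using hy), by simp⟩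

/-- If every column permutation moves two places of `A` to the same row, then the signed sum of
row tabloids over `garnirSet A` vanishes. -/
theorem sum_garnirSet {A : Set (Box μ)}
    (hA : ∀ c ∈ colPerms μ, ∃ a ∈ A, ∃ b ∈ A, a ≠ b ∧ rowIdx (c a) = rowIdx (c b))
    (x : TabSpace K μ V) :
    ∑ g ∈ garnirSet A, signScalar K g • (symRel K μ V).mkQ (placePerm K (Box μ) V g x) = 0 := by
  classical
  let Z : Set (Box μ) → Prop := fun B => ∃ q : Box μ × Box μ,
    q.1 ∈ B ∧ q.2 ∈ B ∧ q.1 ≠ q.2 ∧ rowIdx q.1 = rowIdx q.2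
  have hZ : ∀ g ∈ garnirSet A, Z (g '' A) := by
    intro g hg
    obtain ⟨c, hc, h, hh, rfl⟩ := mem_garnirSet.1 hg
    obtain ⟨a, ha, b, hb, hab, hrow⟩ := hA c hc
    rw [Equiv.Perm.coe_mul, Set.image_comp, image_eq_of_support hh]
    exact ⟨(c a, c b), ⟨a, ha, rfl⟩, ⟨b, hb, rfl⟩, c.injective.ne hab, hrow⟩
  -- Terms cancel in pairs `g`, `τ (g '' A) * g`: a swap within a row changes the sign but not the
  -- row tabloid. The swap is chosen from the set `g '' A` alone, which it preserves, so the same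
  -- swap is chosen for the partner and the pairing is an involution.
  let τ : Set (Box μ) → Equiv.Perm (Box μ) := fun B =>
    if h : Z B then Equiv.swap h.choose.1 h.choose.2 else 1
  have hτ : ∀ g ∈ garnirSet A, ∃ u ∈ g '' A, ∃ v ∈ g '' A, u ≠ v ∧ rowIdx u = rowIdx v ∧
      τ (g '' A) = Equiv.swap u v := by
    intro g hg
    have h := hZ g hg
    exact ⟨_, h.choose_spec.1, _, h.choose_spec.2.1, h.choose_spec.2.2.1, h.choose_spec.2.2.2,
      dif_pos h⟩
  refine Finset.sum_involution (fun g _ => τ (g '' A) * g) ?_ ?_ ?_ ?_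
  · intro g hg
    obtain ⟨u, -, v, -, huv, hrow, h⟩ := hτ g hg
    rw [h, signScalar_mul, signScalar_swap K huv, placePerm_mul,
      mkQ_placePerm (swap_mem_rowPerms hrow), ← add_smul]
    simp
  · intro g hg _ h1
    obtain ⟨u, -, v, -, huv, hrow, h⟩ := hτ g hg
    rw [h, mul_eq_right, Equiv.swap_eq_one_iff] at h1
    exact huv h1
  · intro g hg
    obtain ⟨u, hu, v, hv, huv, hrow, h⟩ := hτ g hg
    rw [h]
    obtain ⟨c, hc, k, hk, rfl⟩ := mem_garnirSet.1 hg
    rw [Equiv.Perm.coe_mul, Set.image_comp, image_eq_of_support hk] at hu hv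
    obtain ⟨a, ha, rfl⟩ := hu
    obtain ⟨b, hb, rfl⟩ := hv
    refine mem_garnirSet.2 ⟨c, hc, Equiv.swap a b * k, fun y hy => ?_, ?_⟩
    · rw [Equiv.Perm.mul_apply, hk y hy,
        Equiv.swap_apply_of_ne_of_ne (ne_of_mem_of_not_mem ha hy).symm
          (ne_of_mem_of_not_mem hb hy).symm]
    · rw [← mul_assoc, ← mul_assoc, Equiv.mul_swap_eq_swap_mul]
  · intro g hg
    obtain ⟨u, hu, v, hv, huv, hrow, h⟩ := hτ g hg
    have himg : (⇑(τ (g '' A) * g)) '' A = g '' A := by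
      rw [Equiv.Perm.coe_mul, Set.image_comp, h]
      exact image_eq_of_support fun y hy => Equiv.swap_apply_of_ne_of_ne
        (ne_of_mem_of_not_mem hu hy).symm (ne_of_mem_of_not_mem hv hy).symm
    simp only [himg]
    rw [h, ← mul_assoc, Equiv.swap_mul_self, one_mul]

/-- The Garnir relation: a signed sum over representatives of the cosets of the column permutations
in `garnirSet A` annihilates polytabloids. -/
theorem sum_polytabloid_garnir {A : Set (Box μ)}
    (hA : ∀ c ∈ colPerms μ, ∃ a ∈ A, ∃ b ∈ A, a ≠ b ∧ rowIdx (c a) = rowIdx (c b))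
    {S : Set (Equiv.Perm (Box μ))} (hS : Subgroup.IsComplement (colPerms μ : Set _) S)
    {T : Finset (Equiv.Perm (Box μ))} (hT : ∀ s, s ∈ T ↔ s ∈ S ∧ s ∈ garnirSet A)
    (x : TabSpace K μ V) :
    ∑ s ∈ T, signScalar K s • polytabloid K μ V (placePerm K (Box μ) V s x) = 0 := by
  rw [← sum_garnirSet hA x]
  simp only [polytabloid_apply, Finset.smul_sum, smul_smul, ← signScalar_mul, ← placePerm_mul]
  rw [← Finset.sum_product']
  -- `garnirSet A` is stable under left multiplication by column permutations, so each of its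
  -- elements factors uniquely as a column permutation times an element of `T`.
  refine Finset.sum_bij (fun q _ => q.2.1 * q.1) ?_ ?_ ?_ ?_
  · rintro ⟨s, c⟩ hq
    obtain ⟨c', hc', h, hh, hs⟩ := mem_garnirSet.1 ((hT s).1 (Finset.mem_product.1 hq).1).2
    exact mem_garnirSet.2 ⟨c.1 * c', mul_mem c.2 hc', h, hh, by simp only [hs, mul_assoc]⟩
  · rintro ⟨s, c⟩ hq ⟨s', c'⟩ hq' h
    have h1 := @hS.1 (⟨c.1, c.2⟩, ⟨s, ((hT s).1 (Finset.mem_product.1 hq).1).1⟩)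
      (⟨c'.1, c'.2⟩, ⟨s', ((hT s').1 (Finset.mem_product.1 hq').1).1⟩) h
    simp only [Prod.mk.injEq, Subtype.mk.injEq] at h1
    exact Prod.ext h1.2 (Subtype.ext h1.1)
  · intro g hg
    obtain ⟨⟨c, s⟩, h⟩ := hS.2 g
    simp only at h
    obtain ⟨c', hc', k, hk, hg'⟩ := mem_garnirSet.1 hg
    refine ⟨(s.1, ⟨c.1, c.2⟩), Finset.mem_product.2 ⟨(hT _).2 ⟨s.2, mem_garnirSet.2
      ⟨c.1⁻¹ * c', mul_mem (inv_mem c.2) hc', k, hk, ?_⟩⟩, Finset.mem_univ _⟩, h⟩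
    rw [mul_assoc, ← hg', ← h, inv_mul_cancel_left]
  · rintro ⟨s, c⟩ -
    simp only [signScalar_mul, mul_comm]

/-- The places of column `j` from row `i` on and of column `j'` up to row `i`. -/
def garnirBelt (μ : YoungDiagram) (i j j' : ℕ) : Set (Box μ) :=
  {x | (colIdx x = j ∧ i ≤ rowIdx x) ∨ (colIdx x = j' ∧ rowIdx x ≤ i)}

/-- Pigeonhole: the belt contains `μ.colLen j + 1` boxes, and a column permutation keeps them in
columns `j` and `j'`, where only `μ.colLen j` rows are available because `j < j'`. -/
theorem exists_rowIdx_eq_of_garnirBelt {i j j' : ℕ} (hj : j < j') (h : (i, j') ∈ μ)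
    {c : Equiv.Perm (Box μ)} (hc : c ∈ colPerms μ) :
    ∃ a ∈ garnirBelt μ i j j', ∃ b ∈ garnirBelt μ i j j', a ≠ b ∧
      rowIdx (c a) = rowIdx (c b) := by
  have hc' : ∀ x, colIdx (c x) = colIdx x := hc
  have hi : i < μ.colLen j' := YoungDiagram.mem_iff_lt_colLen.1 h
  -- Indices `0, …, i` enumerate the part of column `j'`; the later ones are shifted by one and
  -- enumerate rows `i, i + 1, …` of column `j`, so row `i` is used twice.
  let g : Fin (μ.colLen j + 1) → Box μ := fun k =>
    if hk : k.1 ≤ i then ⟨(k.1, j'), YoungDiagram.mem_iff_lt_colLen.2 (hk.trans_lt hi)⟩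
    else ⟨(k.1 - 1, j), YoungDiagram.mem_iff_lt_colLen.2 (by have := k.2; omega)⟩
  have hg : ∀ k, g k ∈ garnirBelt μ i j j' := by
    intro k
    by_cases hk : k.1 ≤ i
    · simp only [g, dif_pos hk]
      exact Or.inr ⟨rfl, hk⟩
    · simp only [g, dif_neg hk]
      exact Or.inl ⟨rfl, Nat.le_sub_one_of_lt (not_le.1 hk)⟩
  have hginj : Function.Injective g := by
    intro k k' hkk
    by_cases hk : k.1 ≤ i <;> by_cases hk' : k'.1 ≤ i <;>
      simp only [g, hk, hk', dif_pos, dif_neg, not_false_eq_true, Subtype.mk.injEq,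
        Prod.mk.injEq] at hkk <;> (apply Fin.ext; omega)
  have hlt : ∀ k, rowIdx (c (g k)) < μ.colLen j := by
    intro k
    refine (rowIdx_lt _).trans_le (μ.colLen_anti _ _ ?_)
    rw [hc']
    rcases hg k with h | h <;> omega
  obtain ⟨k, k', hkk, heq⟩ := Fintype.exists_ne_map_eq_of_card_lt
    (fun k => (⟨rowIdx (c (g k)), hlt k⟩ : Fin (μ.colLen j))) (by simp)
  exact ⟨_, hg k, _, hg k', hginj.ne hkk, Fin.mk.inj heq⟩

end Garnir

end InverseSchur
end

noncomputable section
namespace InverseSchur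
open scoped TensorProduct

variable {K : Type*} [Field K] {μ : YoungDiagram} {V : Type*} [AddCommGroup V] [Module K V]

theorem placePerm_tabVec {ι : Type*} (b : Module.Basis ι K V) (s : Equiv.Perm (Box μ))
    (t : Box μ → ι) : placePerm K (Box μ) V s (tabVec μ b t) = tabVec μ b (t ∘ ⇑s⁻¹) :=
  placePerm_tprod (Box μ) s _

theorem tabVec_eq_basis {ι : Type*} (b : Module.Basis ι K V) (t : Box μ → ι) :
    tabVec μ b t = Basis.piTensorProduct (fun _ : Box μ => b) t :=
  (Basis.piTensorProduct_apply (fun _ : Box μ => b) t).symm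

theorem span_range_tabVec {ι : Type*} (b : Module.Basis ι K V) :
    Submodule.span K (Set.range (tabVec μ b)) = ⊤ := by
  rw [← (Basis.piTensorProduct (fun _ : Box μ => b)).span_eq]
  congr 2
  exact funext (tabVec_eq_basis b)

/-! ### Straightening into semistandard tableaux. -/

section Straightening

variable {d : ℕ} (b : Module.Basis (Fin d) K V)

/-- The relation by which straightening makes progress. -/
def Before (u t : Box μ → Fin d) : Prop :=
  weight colIdx t < weight colIdx u ∨
    weight colIdx t = weight colIdx u ∧ weight rowIdx t < weight rowIdx u

/-- Garnir relations raise the column weight; column swaps keep it and raise the row weight. There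
are only finitely many tableaux, so this stops. -/
theorem wellFounded_before : WellFounded (Before (μ := μ) (d := d)) := by
  have : IsTrans (Box μ → Fin d) Before := ⟨fun _ _ _ h h' => by unfold Before at *; omega⟩
  have : Std.Irrefl (Before (μ := μ) (d := d)) := ⟨fun _ h => by unfold Before at h; omega⟩
  exact Finite.wellFounded_of_trans_of_irrefl _

theorem weight_colIdx_comp_inv {c : Equiv.Perm (Box μ)} (hc : c ∈ colPerms μ)
    (t : Box μ → Fin d) : weight colIdx (t ∘ ⇑c⁻¹) = weight colIdx t := by
  rw [weight_comp_perm, inv_inv]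
  congr 1
  exact funext hc

theorem weight_rowIdx_lt_swap {t : Box μ → Fin d} {c c' : Box μ} (h : rowIdx c < rowIdx c')
    (ht : t c' < t c) : weight rowIdx t < weight rowIdx (t ∘ ⇑(Equiv.swap c c')⁻¹) := by
  have hne : c ≠ c' := fun h' => by simp [h'] at h
  have h2 : (0 : ℤ) < ((rowIdx (Equiv.swap c c' c') : ℤ) - rowIdx c') * ((t c' : ℤ) - t c) := by
    rw [Equiv.swap_apply_right]
    have : (t c' : ℕ) < t c := ht
    exact mul_pos_of_neg_of_neg (by omega) (by omega)
  refine weight_lt_weight_comp (t c) (fun x => ?_) ⟨c', h2⟩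
  by_cases hx : x = c
  · simp [hx]
  by_cases hx' : x = c'
  · exact hx' ▸ h2.le
  · simp [Equiv.swap_apply_of_ne_of_ne hx hx']

/-- Entries that move right are at least `θ` and entries that move left are below it, so no box
lowers the column weight. Since `s` is not a column permutation, some entry does move left, and it
contributes strictly. -/
theorem weight_colIdx_lt_garnir {t : Box μ → Fin d} {i j j' : ℕ} (hj : j < j') {θ : Fin d}
    (hA : ∀ x, colIdx x = j → i ≤ rowIdx x → θ ≤ t x)
    (hB : ∀ x, colIdx x = j' → rowIdx x ≤ i → t x < θ)
    {s : Equiv.Perm (Box μ)} (hs : ∀ x, x ∉ garnirBelt μ i j j' → s x = x)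
    (hs' : s ∉ colPerms μ) : weight colIdx t < weight colIdx (t ∘ ⇑s⁻¹) := by
  have hmem : ∀ x, x ∈ garnirBelt μ i j j' → s x ∈ garnirBelt μ i j j' := fun x hx =>
    image_eq_of_support hs ▸ Set.mem_image_of_mem s hx
  have hcol : ∀ x, x ∈ garnirBelt μ i j j' → colIdx (s x) = j ∨ colIdx (s x) = j' := fun x hx =>
    (hmem x hx).imp And.left And.left
  have hnonneg : ∀ x, 0 ≤ ((colIdx (s x) : ℤ) - colIdx x) * ((t x : ℤ) - θ) := by
    intro x
    by_cases hx : x ∈ garnirBelt μ i j j'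
    · have h1 := hcol x hx
      rcases hx with ⟨hx, hx'⟩ | ⟨hx, hx'⟩
      · have h2 : (θ : ℕ) ≤ t x := hA x hx hx'
        exact mul_nonneg (by omega) (by omega)
      · have h2 : (t x : ℕ) < θ := hB x hx hx'
        exact mul_nonneg_of_nonpos_of_nonpos (by omega) (by omega)
    · simp [hs x hx]
  refine weight_lt_weight_comp θ hnonneg ?_
  by_contra! hall
  -- Only boxes leaving column `j'` are sure to contribute strictly, because `hB` is strict and `hA`
  -- is not. If none leaves, finiteness makes `s` permute column `j'`, hence also column `j`.
  have hBfix : ∀ x, colIdx x = j' → colIdx (s x) = j' := by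
    intro x hx
    by_contra hne
    have hmx : x ∈ garnirBelt μ i j j' := by
      by_contra hx'
      exact hne (by rw [hs x hx', hx])
    have h1 := (hcol x hmx).resolve_right hne
    have h2 : (t x : ℕ) < θ := by
      rcases hmx with ⟨hx', -⟩ | ⟨-, hx'⟩
      · omega
      · exact hB x hx hx'
    refine absurd (hall x) (not_le.2 (mul_pos_of_neg_of_neg ?_ ?_)) <;> omega
  have hcard : ∀ y, colIdx y = j' → ∃ x, colIdx x = j' ∧ s x = y := by
    intro y hy
    let f : {x : Box μ // colIdx x = j'} → {x : Box μ // colIdx x = j'} :=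
      fun x => ⟨s x.1, hBfix x.1 x.2⟩
    have hf : Function.Injective f := fun x x' h =>
      Subtype.ext (s.injective (congrArg Subtype.val h))
    obtain ⟨x, hx⟩ := Finite.surjective_of_injective hf ⟨y, hy⟩
    exact ⟨x.1, x.2, congrArg Subtype.val hx⟩
  refine hs' fun x => ?_
  change colIdx (s x) = colIdx x
  by_cases hx : x ∈ garnirBelt μ i j j'
  · by_cases hxj : colIdx x = j'
    · rw [hBfix x hxj, hxj]
    · have h1 : colIdx x = j := (hx.resolve_right fun h => hxj h.1).1
      rcases hcol x hx with h2 | h2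
      · rw [h1, h2]
      · obtain ⟨z, hz, hz'⟩ := hcard _ h2
        exact absurd (s.injective hz' ▸ hz) hxj
  · rw [hs x hx]

theorem sum_ite_eq_or_smul {X : Type*} [Fintype X] [DecidableEq X] {N : Type*} [AddCommGroup N]
    [Module K N] {p q : X} (h : p ≠ q) (f : X → N) :
    ∑ s, (if s = p ∨ s = q then (1 : K) else 0) • f s = f p + f q := by
  rw [← Finset.sum_pair h]
  simp only [ite_smul, one_smul, zero_smul, Finset.sum_ite, Finset.sum_const_zero, add_zero]
  congr 1
  ext s
  simp

variable {N : Type*} [AddCommGroup N] [Module K N] {φ : TabSpace K μ V →ₗ[K] N}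
  {W : Type*} [AddCommGroup W] [Module K W]

/-- Tableaux straighten modulo every linear map that respects the relations which place
permutations satisfy on the polytabloids of `W`. -/
theorem tabVec_mem_of_relations (h2 : (2 : K) ≠ 0)
    (hφ : ∀ a : Equiv.Perm (Box μ) → K,
      (∀ y : TabSpace K μ W, ∑ s, a s • polytabloid K μ W (placePerm K (Box μ) W s y) = 0) →
      ∀ x, ∑ s, a s • φ (placePerm K (Box μ) V s x) = 0) (t : Box μ → Fin d) :
    tabVec μ b t ∈ Submodule.span K (tabVec μ b '' {u | Semistandard u}) ⊔ LinearMap.ker φ := by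
  induction t using wellFounded_before.induction with
  | _ t ih =>
  by_cases ht : Semistandard t
  · exact Submodule.mem_sup_left (Submodule.subset_span ⟨t, ht, rfl⟩)
  by_cases hcol : ColStrict t
  · have hrow : ∃ c c' : Box μ, rowIdx c = rowIdx c' ∧ colIdx c < colIdx c' ∧ t c' < t c := by
      by_contra! hcon
      exact ht ⟨hcol, hcon⟩
    obtain ⟨c, c', hr, hj, hlt⟩ := hrow
    classical
    -- The transversal contains `1`, so the Garnir relation has the term `t` itself with coefficient
    -- 1; all other terms must be shown to have larger column weight.
    obtain ⟨S, hS, h1S⟩ := Subgroup.exists_isComplement_right (colPerms μ) 1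
    let A := garnirBelt μ (rowIdx c) (colIdx c) (colIdx c')
    let T := (garnirSet A).filter (· ∈ S)
    have hT : ∀ s, s ∈ T ↔ s ∈ S ∧ s ∈ garnirSet A := fun s => by
      simp only [T, Finset.mem_filter, and_comm]
    have h1T : (1 : Equiv.Perm (Box μ)) ∈ T :=
      (hT 1).2 ⟨h1S, mem_garnirSet.2 ⟨1, one_mem _, 1, fun _ _ => rfl, rfl⟩⟩
    have hrel := hφ (fun s => if s ∈ T then signScalar K s else 0) (fun y => by
      simp only [ite_smul, zero_smul, Finset.sum_ite_mem, Finset.univ_inter]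
      exact sum_polytabloid_garnir (fun k hk => exists_rowIdx_eq_of_garnirBelt hj
        (by rw [hr]; exact c'.2) hk) hS hT y) (tabVec μ b t)
    simp only [ite_smul, zero_smul, Finset.sum_ite_mem, Finset.univ_inter] at hrel
    have hker : ∑ s ∈ T, signScalar K s • placePerm K (Box μ) V s (tabVec μ b t) ∈
        LinearMap.ker φ := by
      rw [LinearMap.mem_ker, map_sum]
      simpa only [map_smul] using hrel
    rw [← Finset.add_sum_erase _ _ h1T, signScalar_one, one_smul, placePerm_one] at hker
    rw [← Submodule.add_mem_iff_left _ (y := ∑ s ∈ T.erase 1,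
      signScalar K s • placePerm K (Box μ) V s (tabVec μ b t))]
    · exact Submodule.mem_sup_right hker
    refine Submodule.sum_mem _ fun s hs => Submodule.smul_mem _ _ ?_
    rw [placePerm_tabVec]
    refine ih _ (Or.inl ?_)
    obtain ⟨hs1, hsT⟩ := Finset.mem_erase.1 hs
    obtain ⟨k, hk, g, hg, rfl⟩ := mem_garnirSet.1 ((hT s).1 hsT).2
    -- Otherwise `k * g` would be a column permutation, in the coset represented by `1`.
    have hgcol : g ∉ colPerms μ := by
      intro hgc
      have := @hS.1 (⟨k * g, mul_mem hk hgc⟩, ⟨1, h1S⟩) (⟨1, one_mem _⟩, ⟨_, ((hT _).1 hsT).1⟩)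
        (by simp)
      simp only [Prod.mk.injEq, Subtype.mk.injEq] at this
      exact hs1 this.1
    -- The threshold is `t c`: strict columns give entries at least `t c` from `c` down, and at most
    -- `t c' < t c` from `c'` up.
    have hw := weight_colIdx_lt_garnir (t := t) hj (θ := t c) (fun x hx hx' => by
        rcases hx'.lt_or_eq with h | h
        · exact (hcol c x hx.symm h).le
        · exact le_of_eq (congrArg t (Subtype.ext (Prod.ext h hx.symm)))) (fun x hx hx' => by
        refine lt_of_le_of_lt ?_ hlt
        rw [hr] at hx'
        rcases hx'.lt_or_eq with h | h
        · exact (hcol x c' hx h).le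
        · exact le_of_eq (congrArg t (Subtype.ext (Prod.ext h hx)))) hg hgcol
    rwa [mul_inv_rev, Equiv.Perm.coe_mul, ← Function.comp_assoc, weight_colIdx_comp_inv hk]
  · unfold ColStrict at hcol
    push Not at hcol
    obtain ⟨c, c', hc, hr, hle⟩ := hcol
    have hne : c ≠ c' := fun h => by simp [h] at hr
    have hne1 : Equiv.swap c c' ≠ 1 := fun h => hne (Equiv.swap_eq_one_iff.1 h)
    have hrel := hφ (fun s => if s = 1 ∨ s = Equiv.swap c c' then 1 else 0) (fun y => by
      rw [sum_ite_eq_or_smul hne1.symm fun s => polytabloid K μ W (placePerm K (Box μ) W s y), placePerm_one,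
        polytabloid_placePerm_swap hne hc, add_neg_cancel]) (tabVec μ b t)
    rw [sum_ite_eq_or_smul hne1.symm fun s => φ (placePerm K (Box μ) V s (tabVec μ b t)), placePerm_one,
      placePerm_tabVec] at hrel
    rcases hle.lt_or_eq with hlt | heq
    · rw [← Submodule.add_mem_iff_left _ (ih _ (Or.inr
        ⟨(weight_colIdx_comp_inv (swap_mem_colPerms hc) t).symm, weight_rowIdx_lt_swap hr hlt⟩))]
      exact Submodule.mem_sup_right (by rw [LinearMap.mem_ker, map_add, hrel])
    -- With equal entries the swap fixes `t`, so the relation reads `2 φ(t) = 0`; here the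
    -- characteristic matters.
    · have hswap : t ∘ ⇑(Equiv.swap c c')⁻¹ = t := by
        funext x
        rw [Function.comp_apply, Equiv.swap_inv, Equiv.swap_apply_def]
        split_ifs with h h' <;> simp [*]
      rw [hswap, ← two_smul K, smul_eq_zero] at hrel
      exact Submodule.mem_sup_right (hrel.resolve_left h2)

theorem span_semistandard_sup_ker (h2 : (2 : K) ≠ 0)
    (hφ : ∀ a : Equiv.Perm (Box μ) → K,
      (∀ y : TabSpace K μ W, ∑ s, a s • polytabloid K μ W (placePerm K (Box μ) W s y) = 0) →
      ∀ x, ∑ s, a s • φ (placePerm K (Box μ) V s x) = 0) :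
    Submodule.span K (tabVec μ b '' {u | Semistandard u}) ⊔ LinearMap.ker φ = ⊤ := by
  rw [eq_top_iff, ← span_range_tabVec b, Submodule.span_le]
  rintro _ ⟨t, rfl⟩
  exact tabVec_mem_of_relations b h2 hφ t

end Straightening

/-! ### Linear independence of semistandard polytabloids. -/

section Independence

variable {d : ℕ} (b : Module.Basis (Fin d) K V)

/-- The formal combination of the row contents of the tableaux occurring in a tensor. -/
def contentMap : TabSpace K μ V →ₗ[K] (Multiset (ℕ × Fin d) →₀ K) :=
  (Basis.piTensorProduct fun _ : Box μ => b).constr K fun t => Finsupp.single (rowContent t) 1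

theorem contentMap_tabVec (t : Box μ → Fin d) :
    contentMap b (tabVec μ b t) = Finsupp.single (rowContent t) 1 := by
  rw [tabVec_eq_basis, contentMap, Module.Basis.constr_basis]

theorem contentMap_placePerm {s : Equiv.Perm (Box μ)} (hs : s ∈ rowPerms μ)
    (x : TabSpace K μ V) : contentMap b (placePerm K (Box μ) V s x) = contentMap b x := by
  have h : contentMap b ∘ₗ placePerm K (Box μ) V s = contentMap b := by
    refine (Basis.piTensorProduct fun _ : Box μ => b).ext fun t => ?_
    rw [← tabVec_eq_basis, LinearMap.comp_apply, placePerm_tabVec, contentMap_tabVec,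
      contentMap_tabVec, rowContent_comp_of_mem_rowPerms t (inv_mem hs)]
  exact LinearMap.congr_fun h x

/-- The formal combination of the row contents of the tabloids occurring in an element of the
space of row tabloids. -/
def tabloidContentMap : RowTabloids K μ V →ₗ[K] (Multiset (ℕ × Fin d) →₀ K) :=
  (symRel K μ V).liftQ (contentMap b) (Submodule.span_le.2 (by
    rintro _ ⟨x, s, hs, rfl⟩
    simp [contentMap_placePerm b hs]))

theorem tabloidContentMap_mkQ (x : TabSpace K μ V) :
    tabloidContentMap b ((symRel K μ V).mkQ x) = contentMap b x :=
  Submodule.liftQ_apply _ _ _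

theorem tabloidContentMap_polytabloid (t : Box μ → Fin d) :
    tabloidContentMap b (polytabloid K μ V (tabVec μ b t)) =
      ∑ s : colPerms μ, Finsupp.single (rowContent (t ∘ ⇑(s.1)⁻¹)) (signScalar K s.1) := by
  rw [polytabloid_apply, map_sum]
  refine Finset.sum_congr rfl fun s _ => ?_
  rw [map_smul, tabloidContentMap_mkQ, placePerm_tabVec, contentMap_tabVec,
    Finsupp.smul_single, smul_eq_mul, mul_one]

/-- Row content determines row weight, and every nontrivial column permutation lowers the row weight
of a column-strict tableau; so only the identity contributes. -/
theorem tabloidContentMap_apply_self {t : Box μ → Fin d} (ht : ColStrict t) :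
    tabloidContentMap b (polytabloid K μ V (tabVec μ b t)) (rowContent t) = 1 := by
  rw [tabloidContentMap_polytabloid, Finsupp.finsetSum_apply, Finset.sum_eq_single 1]
  · rw [OneMemClass.coe_one, inv_one, Equiv.Perm.coe_one, Function.comp_id, Finsupp.single_eq_same,
      signScalar_one]
  · intro s _ hs
    refine Finsupp.single_eq_of_ne fun h => hs ?_
    have h1 := ht.eq_one_of_weight_le (inv_mem s.2) (by rw [weight_rowIdx_eq, weight_rowIdx_eq, h])
    exact Subtype.ext (inv_eq_one.1 h1)
  · simp

/-- A column rearrangement of `u` with the row content of `t` would have row weight at least that of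
`u`, hence be `u` itself, and semistandard tableaux are determined by their row content. -/
theorem tabloidContentMap_apply_of_ne {t u : Box μ → Fin d} (ht : Semistandard t)
    (hu : Semistandard u) (h : weight rowIdx u ≤ weight rowIdx t) (hne : u ≠ t) :
    tabloidContentMap b (polytabloid K μ V (tabVec μ b u)) (rowContent t) = 0 := by
  rw [tabloidContentMap_polytabloid, Finsupp.finsetSum_apply]
  refine Finset.sum_eq_zero fun s _ => Finsupp.single_eq_of_ne fun h' => hne ?_
  have h1 := hu.1.eq_one_of_weight_le (inv_mem s.2)
    (h.trans_eq (by rw [weight_rowIdx_eq, weight_rowIdx_eq, h']))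
  rw [h1, Equiv.Perm.coe_one, Function.comp_id] at h'
  exact hu.eq_of_rowContent_eq ht h'.symm

/-- The polytabloids of the semistandard tableaux are linearly independent. -/
theorem linearIndependent_polytabloid :
    LinearIndependent K fun t : {t : Box μ → Fin d // Semistandard t} =>
      polytabloid K μ V (tabVec μ b t.1) := by
  rw [linearIndependent_iff]
  intro a ha
  by_contra hne
  -- Triangularity: for `t` of maximal row weight in the support, the coefficient at the row content
  -- of `t` comes from `t` alone.
  obtain ⟨t, ht, hmax⟩ := Finset.exists_max_image a.support
    (fun u => weight rowIdx u.1) (Finsupp.support_nonempty_iff.2 hne)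
  refine Finsupp.mem_support_iff.1 ht ?_
  have h := DFunLike.congr_fun (congrArg (tabloidContentMap b) ha) (rowContent t.1)
  rw [Finsupp.linearCombination_apply, Finsupp.sum, map_sum, Finsupp.finsetSum_apply,
    Finset.sum_eq_single t, map_smul, Finsupp.smul_apply, tabloidContentMap_apply_self b t.2.1,
    smul_eq_mul, mul_one, map_zero, Finsupp.zero_apply] at h
  · exact h
  · intro u hu hut
    rw [map_smul, Finsupp.smul_apply, tabloidContentMap_apply_of_ne b t.2 u.2 (hmax u hu)
      (fun h => hut (Subtype.ext h)), smul_zero]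
  · exact fun h => absurd ht h

theorem eq_zero_of_mem_span_semistandard {x : TabSpace K μ V}
    (hx : x ∈ Submodule.span K (tabVec μ b '' {u | Semistandard u}))
    (h : polytabloid K μ V x = 0) : x = 0 := by
  rw [Set.image_eq_range, Finsupp.mem_span_range_iff_exists_finsupp] at hx
  obtain ⟨a, rfl⟩ := hx
  have ha := linearIndependent_iff.1 (linearIndependent_polytabloid (K := K) (μ := μ) b) a (by
    rw [Finsupp.linearCombination_apply, ← h, Finsupp.sum, Finsupp.sum, map_sum]
    simp only [map_smul]
    rfl)
  rw [ha, Finsupp.sum_zero_index]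

end Independence

end InverseSchur
end

noncomputable section
namespace InverseSchur
open scoped TensorProduct

variable {K : Type*} [Field K] {n d : ℕ} {μ : YoungDiagram}
  {V : Type*} [AddCommGroup V] [Module K V]

theorem placeRep_tprod (g : Equiv.Perm (Fin n)) (f : Fin n → V) :
    placeRep K n V (MulOpposite.op g) (PiTensorProduct.tprod K f) =
      PiTensorProduct.tprod K (f ∘ g) := by
  refine (placePerm_tprod (Fin n) g⁻¹ f).trans ?_
  rw [inv_inv]
  rfl

/-! ### Substituting tensor factors into tableaux, and the map out of the tensor product. -/

section Substitution

variable {W : Type*} [AddCommGroup W] [Module K W] (b : Module.Basis (Fin n) K W)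

theorem diagRep_tabVec {ρ : Representation K (Equiv.Perm (Fin n)) W}
    (hρ : ∀ g i, ρ g (b i) = b (g i)) (g : Equiv.Perm (Fin n)) (t : Box μ → Fin n) :
    diagRep (Box μ) ρ g (tabVec μ b t) = tabVec μ b (g ∘ t) := by
  rw [tabVec, diagRep_tprod, tabVec]
  simp only [hρ, Function.comp_apply]

open Classical in
/-- Substituting the factors of a tensor for the entries of a tableau. Tableaux with a repeated
entry are sent to zero. -/
def substitute (μ : YoungDiagram) (V : Type*) [AddCommGroup V] [Module K V] :
    TabSpace K μ W →ₗ[K] (⨂[K] _ : Fin n, V) →ₗ[K] TabSpace K μ V :=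
  (Basis.piTensorProduct fun _ : Box μ => b).constr K fun t =>
    if h : Function.Bijective t then
      (PiTensorProduct.reindex K (fun _ : Fin n => V) (Equiv.ofBijective t h).symm).toLinearMap
    else 0

theorem substitute_of_bijective {t : Box μ → Fin n} (h : Function.Bijective t) (f : Fin n → V) :
    substitute b μ V (tabVec μ b t) (PiTensorProduct.tprod K f) =
      PiTensorProduct.tprod K (f ∘ t) := by
  rw [tabVec_eq_basis, substitute, Module.Basis.constr_basis, dif_pos h]
  exact PiTensorProduct.reindex_tprod (R := K) (s := fun _ : Fin n => V) _ f

theorem substitute_of_not_bijective {t : Box μ → Fin n} (h : ¬Function.Bijective t) :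
    substitute b μ V (tabVec μ b t) = 0 := by
  rw [tabVec_eq_basis, substitute, Module.Basis.constr_basis, dif_neg h]

/-- Place permutations preserve bijectivity of a tableau, so the value zero elsewhere does no harm.
This compatibility lets substitution pass to row tabloids and commute with polytabloids. -/
theorem substitute_placePerm (s : Equiv.Perm (Box μ)) (y : TabSpace K μ W) :
    substitute b μ V (placePerm K (Box μ) _ s y) =
      placePerm K (Box μ) V s ∘ₗ substitute b μ V y := by
  have h : substitute b μ V ∘ₗ placePerm K (Box μ) _ s =
      (placePerm K (Box μ) V s).compRight K ∘ₗ substitute b μ V := by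
    refine (Basis.piTensorProduct fun _ : Box μ => b).ext fun t => ?_
    rw [← tabVec_eq_basis b, LinearMap.comp_apply, LinearMap.comp_apply, placePerm_tabVec]
    by_cases ht : Function.Bijective t
    · ext f
      simp only [LinearMap.compMultilinearMap_apply, LinearMap.compRight_apply,
        LinearMap.comp_apply, substitute_of_bijective b ht,
        substitute_of_bijective b (ht.comp s⁻¹.bijective), placePerm_tprod]
      rfl
    · rw [substitute_of_not_bijective b ht, substitute_of_not_bijective b
        (fun h => ht ((Function.Bijective.of_comp_iff t s⁻¹.bijective).1 h)), map_zero]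
  exact LinearMap.congr_fun h y

/-- Renumbering the entries by `g` amounts to permuting the tensor factors by `g`; this is what
makes `fromGTensor` well defined on the balanced tensor product. -/
theorem substitute_diagRep {ρ : Representation K (Equiv.Perm (Fin n)) W}
    (hρ : ∀ g i, ρ g (b i) = b (g i)) (g : Equiv.Perm (Fin n)) (y : TabSpace K μ W) :
    substitute b μ V (diagRep (Box μ) ρ g y) =
      substitute b μ V y ∘ₗ placeRep K n V (MulOpposite.op g) := by
  have h : substitute b μ V ∘ₗ diagRep (Box μ) ρ g =
      LinearMap.lcomp K _ (placeRep K n V (MulOpposite.op g)) ∘ₗ substitute b μ V := by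
    refine (Basis.piTensorProduct fun _ : Box μ => b).ext fun t => ?_
    rw [← tabVec_eq_basis b, LinearMap.comp_apply, LinearMap.comp_apply, diagRep_tabVec b hρ]
    by_cases ht : Function.Bijective t
    · ext f
      simp only [LinearMap.compMultilinearMap_apply, LinearMap.lcomp_apply,
        substitute_of_bijective b ht, substitute_of_bijective b (g.bijective.comp ht), placeRep_tprod]
      rfl
    · rw [substitute_of_not_bijective b ht, substitute_of_not_bijective b
        (fun h => ht ((Function.Bijective.of_comp_iff' g.bijective t).1 h)), map_zero]
  exact LinearMap.congr_fun h y

theorem symRel_le_ker_substitute :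
    symRel K μ W ≤
      LinearMap.ker ((symRel K μ V).mkQ.compRight K ∘ₗ substitute b μ V) := by
  refine Submodule.span_le.2 ?_
  rintro _ ⟨y, s, hs, rfl⟩
  rw [SetLike.mem_coe, LinearMap.mem_ker, map_sub, sub_eq_zero]
  refine LinearMap.ext fun x => ?_
  rw [LinearMap.comp_apply, LinearMap.comp_apply, substitute_placePerm, LinearMap.compRight_apply,
    LinearMap.compRight_apply, LinearMap.comp_apply, LinearMap.comp_apply, LinearMap.comp_apply,
    mkQ_placePerm hs]

/-- Substituting the factors of a tensor for the entries of a row tabloid. -/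
def substituteTabloid (μ : YoungDiagram) (V : Type*) [AddCommGroup V] [Module K V] :
    RowTabloids K μ W →ₗ[K] (⨂[K] _ : Fin n, V) →ₗ[K] RowTabloids K μ V :=
  (symRel K μ W).liftQ ((symRel K μ V).mkQ.compRight K ∘ₗ substitute b μ V)
    (symRel_le_ker_substitute b)

theorem substituteTabloid_mkQ (y : TabSpace K μ W) (x : ⨂[K] _ : Fin n, V) :
    substituteTabloid b μ V ((symRel K μ W).mkQ y) x =
      (symRel K μ V).mkQ (substitute b μ V y x) := by
  rfl

theorem substituteTabloid_polytabloid (y : TabSpace K μ W) (x : ⨂[K] _ : Fin n, V) :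
    substituteTabloid b μ V (polytabloid K μ W y) x =
      polytabloid K μ V (substitute b μ V y x) := by
  rw [polytabloid_apply, polytabloid_apply, map_sum, LinearMap.sum_apply]
  refine Finset.sum_congr rfl fun s _ => ?_
  rw [map_smul, LinearMap.smul_apply, substituteTabloid_mkQ, substitute_placePerm,
    LinearMap.comp_apply]

theorem substituteTabloid_rowTabloidsRep {ρ : Representation K (Equiv.Perm (Fin n)) W}
    (hρ : ∀ g i, ρ g (b i) = b (g i)) (g : Equiv.Perm (Fin n))
    (u : RowTabloids K μ W) (x : ⨂[K] _ : Fin n, V) :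
    substituteTabloid b μ V (rowTabloidsRep μ ρ g u) x =
      substituteTabloid b μ V u (placeRep K n V (MulOpposite.op g) x) := by
  obtain ⟨y, rfl⟩ := (symRel K μ W).mkQ_surjective u
  have h : rowTabloidsRep μ ρ g ((symRel K μ W).mkQ y) =
      (symRel K μ W).mkQ (diagRep (Box μ) ρ g y) := rfl
  rw [h, substituteTabloid_mkQ, substitute_diagRep b hρ, LinearMap.comp_apply, substituteTabloid_mkQ]

end Substitution

theorem permRep_permBasis (g : Equiv.Perm (Fin n)) (i : Fin n) :
    permRep K n g (permBasis K n i) = permBasis K n (g i) := by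
  simp only [permBasis, Finsupp.coe_basisSingleOne]
  exact Finsupp.mapDomain_single (f := g) (a := i) (b := (1 : K))

/-- The map `E^{⊗ n} ⊗_{K S_n} S^μ → Sym^μ E` that substitutes the factors of a tensor for the
entries of a polytabloid. -/
def fromGTensor (K : Type*) [Field K] (n d : ℕ) (μ : YoungDiagram) :
    GTensor K d (spechtRep K n μ) →ₗ[K] RowTabloids K μ (Fin d → K) :=
  (balancedRel _ _).liftQ
    (TensorProduct.lift (substituteTabloid (permBasis K n) μ (Fin d → K) ∘ₗ (Specht K n μ).subtype).flip)
    (Submodule.span_le.2 (by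
      rintro _ ⟨s, x, u, rfl⟩
      refine LinearMap.mem_ker.2 ?_
      rw [map_sub, TensorProduct.lift.tmul, TensorProduct.lift.tmul, sub_eq_zero]
      exact (substituteTabloid_rowTabloidsRep _ permRep_permBasis s u.1 x).symm))

theorem fromGTensor_tmul (x : ⨂[K] _ : Fin n, Fin d → K) (u : Specht K n μ) :
    fromGTensor K n d μ ((balancedRel _ _).mkQ (x ⊗ₜ u)) =
      substituteTabloid (permBasis K n) μ (Fin d → K) u.1 x :=
  rfl

theorem sum_smul_mkQ_tmul {S : Type*} [Group S] {M : Type*} [AddCommGroup M] [Module K M]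
    {U : Type*} [AddCommGroup U] [Module K U] (r : Representation K Sᵐᵒᵖ M)
    (σ : Representation K S U) {X : Type*} [Fintype X] {a : X → K} {u : X → U} (x : M)
    (h : ∑ s, a s • u s = 0) : ∑ s, a s • (balancedRel r σ).mkQ (x ⊗ₜ u s) = 0 := by
  simp only [← map_smul, ← map_sum, ← TensorProduct.tmul_smul, ← TensorProduct.tmul_sum, h,
    TensorProduct.tmul_zero, map_zero]

/-! ### The map back from a numbering of the boxes, and the isomorphism. -/

section Numbering

variable (e : Box μ ≃ Fin n)

/-- The polytabloid of a numbering of the boxes. -/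
def numberingPolytabloid (K : Type*) [Field K] : Specht K n μ :=
  ⟨polytabloid K μ (Fin n →₀ K) (tabVec μ (permBasis K n) e), Submodule.subset_span ⟨e, e.injective, rfl⟩⟩

theorem spechtRep_numberingPolytabloid (g : Equiv.Perm (Fin n)) :
    (spechtRep K n μ g (numberingPolytabloid e K)).1 =
      polytabloid K μ (Fin n →₀ K) (tabVec μ (permBasis K n) (g ∘ e)) := by
  rw [← diagRep_tabVec _ permRep_permBasis, ← rowTabloidsRep_polytabloid]
  rfl

/-- The map from the tensor power indexed by the boxes to `E^{⊗ n} ⊗_{K S_n} S^μ` given by a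
numbering of the boxes and its polytabloid. -/
def toGTensor (K : Type*) [Field K] (d : ℕ) :
    TabSpace K μ (Fin d → K) →ₗ[K] GTensor K d (spechtRep K n μ) :=
  (balancedRel _ _).mkQ ∘ₗ (TensorProduct.mk K _ _).flip (numberingPolytabloid e K) ∘ₗ
    (PiTensorProduct.reindex K (fun _ : Box μ => Fin d → K) e).toLinearMap

theorem toGTensor_apply (x : TabSpace K μ (Fin d → K)) :
    toGTensor e K d x = (balancedRel _ _).mkQ
      (PiTensorProduct.reindex K (fun _ : Box μ => Fin d → K) e x ⊗ₜ
        numberingPolytabloid e K) :=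
  rfl

theorem mkQ_placeRep_tmul (s : Equiv.Perm (Fin n)) (x : ⨂[K] _ : Fin n, Fin d → K)
    (u : Specht K n μ) :
    (balancedRel (placeRep K n (Fin d → K)) (spechtRep K n μ)).mkQ
        (placeRep K n _ (MulOpposite.op s) x ⊗ₜ u) =
      (balancedRel (placeRep K n (Fin d → K)) (spechtRep K n μ)).mkQ
        (x ⊗ₜ spechtRep K n μ s u) := by
  rw [← sub_eq_zero, ← map_sub, Submodule.mkQ_apply, Submodule.Quotient.mk_eq_zero]
  exact Submodule.subset_span ⟨s, x, u, rfl⟩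

theorem fromGTensor_toGTensor (x : TabSpace K μ (Fin d → K)) :
    fromGTensor K n d μ (toGTensor e K d x) = polytabloid K μ (Fin d → K) x := by
  rw [toGTensor_apply, fromGTensor_tmul]
  refine (substituteTabloid_polytabloid _ _ _).trans (congrArg _ ?_)
  have h : substitute (permBasis K n) μ _ (tabVec μ (permBasis K n) e) ∘ₗ
      (PiTensorProduct.reindex K (fun _ : Box μ => Fin d → K) e).toLinearMap = LinearMap.id := by
    refine PiTensorProduct.ext (MultilinearMap.ext fun f => ?_)
    simp only [LinearMap.compMultilinearMap_apply, LinearMap.comp_apply, LinearEquiv.coe_coe,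
      LinearMap.id_apply]
    refine (congrArg _ (PiTensorProduct.reindex_tprod (R := K)
      (s := fun _ : Box μ => Fin d → K) e f)).trans ?_
    rw [substitute_of_bijective _ e.bijective]
    congr 1
    funext c
    simp
  exact LinearMap.congr_fun h x

/-- On pure tensors, `f ∘ s⁻¹ ∘ e⁻¹ = (f ∘ e⁻¹) ∘ (e s⁻¹ e⁻¹)`; the inverse appears because
`placeRep` composes with `g` and `placePerm` with `s⁻¹`. -/
theorem reindex_placePerm (s : Equiv.Perm (Box μ)) (x : TabSpace K μ V) :
    PiTensorProduct.reindex K (fun _ : Box μ => V) e (placePerm K (Box μ) V s x) =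
      placeRep K n V (MulOpposite.op (e.permCongr s⁻¹))
        (PiTensorProduct.reindex K (fun _ : Box μ => V) e x) := by
  have h : (PiTensorProduct.reindex K (fun _ : Box μ => V) e).toLinearMap ∘ₗ
      placePerm K (Box μ) V s = placeRep K n V (MulOpposite.op (e.permCongr s⁻¹)) ∘ₗ
        (PiTensorProduct.reindex K (fun _ : Box μ => V) e).toLinearMap := by
    refine PiTensorProduct.ext (MultilinearMap.ext fun f => ?_)
    simp only [LinearMap.compMultilinearMap_apply, LinearMap.comp_apply, LinearEquiv.coe_coe,
      placePerm_tprod]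
    refine (PiTensorProduct.reindex_tprod (R := K) (s := fun _ : Box μ => V) e _).trans ?_
    refine Eq.trans ?_ (congrArg _ (PiTensorProduct.reindex_tprod (R := K)
      (s := fun _ : Box μ => V) e f)).symm
    refine Eq.trans ?_ (placeRep_tprod _ _).symm
    congr 1
    funext i
    rw [Function.comp_apply, Equiv.permCongr_apply, Equiv.symm_apply_apply]
  exact LinearMap.congr_fun h x

theorem toGTensor_placePerm (s : Equiv.Perm (Box μ)) (x : TabSpace K μ (Fin d → K)) :
    toGTensor e K d (placePerm K (Box μ) _ s x) = (balancedRel _ _).mkQ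
      (PiTensorProduct.reindex K (fun _ : Box μ => Fin d → K) e x ⊗ₜ
        spechtRep K n μ (e.permCongr s⁻¹) (numberingPolytabloid e K)) := by
  rw [toGTensor_apply, reindex_placePerm, mkQ_placeRep_tmul]

/-- Balancing moves a place permutation to the Specht factor, where `(e s⁻¹ e⁻¹) ∘ e = e ∘ s⁻¹`
turns it into a place permutation of the numbering `e`. The relation `ha` is needed only for that
tableau. -/
theorem sum_smul_toGTensor_placePerm {a : Equiv.Perm (Box μ) → K}
    (ha : ∀ y : TabSpace K μ (Fin n →₀ K),
      ∑ s, a s • polytabloid K μ (Fin n →₀ K) (placePerm K (Box μ) _ s y) = 0)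
    (x : TabSpace K μ (Fin d → K)) :
    ∑ s, a s • toGTensor e K d (placePerm K (Box μ) _ s x) = 0 := by
  have h : ∑ s, a s • spechtRep K n μ (e.permCongr s⁻¹) (numberingPolytabloid e K) = 0 := by
    refine Subtype.ext ?_
    rw [Submodule.coe_sum, Submodule.coe_zero, ← ha (tabVec μ (permBasis K n) e)]
    refine Finset.sum_congr rfl fun s _ => ?_
    have he : ⇑(e.permCongr s⁻¹) ∘ ⇑e = ⇑e ∘ ⇑s⁻¹ := funext fun c => by
      simp [Equiv.permCongr_apply]
    rw [Submodule.coe_smul, spechtRep_numberingPolytabloid, placePerm_tabVec, he]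
  simp only [toGTensor_placePerm]
  exact sum_smul_mkQ_tmul _ _ _ h

/-- A tableau with distinct entries is a bijection onto `Fin n`, hence `g ∘ e` for some `g`; the
polytabloid of `e` therefore generates the Specht module, and `g` moves across the tensor sign. -/
theorem toGTensor_surjective : Function.Surjective (toGTensor e K d) := by
  rw [← LinearMap.range_eq_top, eq_top_iff]
  rintro z -
  obtain ⟨w, rfl⟩ := (balancedRel _ _).mkQ_surjective z
  induction w using TensorProduct.induction_on with
  | zero => simp
  | add w w' h h' => rw [map_add]; exact add_mem h h'
  | tmul x u =>
    obtain ⟨u, hu⟩ := u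
    induction hu using Submodule.span_induction with
    | mem u hu =>
      obtain ⟨t, ht, rfl⟩ := hu
      have hcard : Fintype.card (Box μ) = Fintype.card (Fin n) := Fintype.card_congr e
      let t' := Equiv.ofBijective t ((Fintype.bijective_iff_injective_and_card t).2 ⟨ht, hcard⟩)
      have hu : (⟨_, Submodule.subset_span ⟨t, ht, rfl⟩⟩ : Specht K n μ) =
          spechtRep K n μ (e.symm.trans t') (numberingPolytabloid e K) := by
        refine Subtype.ext ?_
        have he : ⇑(e.symm.trans t') ∘ ⇑e = t := funext fun c => by simp [t']
        rw [spechtRep_numberingPolytabloid, he]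
      rw [hu, ← mkQ_placeRep_tmul]
      refine ⟨(PiTensorProduct.reindex K (fun _ : Box μ => Fin d → K) e).symm
        (placeRep K n _ (MulOpposite.op (e.symm.trans t')) x), ?_⟩
      rw [toGTensor_apply, LinearEquiv.apply_symm_apply]
    | zero =>
      have h : (⟨0, zero_mem _⟩ : Specht K n μ) = 0 := rfl
      rw [h, TensorProduct.tmul_zero, map_zero]
      exact zero_mem _
    | add u v hu hv h h' =>
      have heq : (⟨u + v, add_mem hu hv⟩ : Specht K n μ) = ⟨u, hu⟩ + ⟨v, hv⟩ := rfl
      rw [heq, TensorProduct.tmul_add, map_add]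
      exact add_mem h h'
    | smul a u hu h =>
      have heq : (⟨a • u, Submodule.smul_mem _ a hu⟩ : Specht K n μ) = a • ⟨u, hu⟩ := rfl
      rw [heq, TensorProduct.tmul_smul, map_smul]
      exact Submodule.smul_mem _ a h

theorem toGTensor_diagRep (g : GL (Fin d) K) (x : TabSpace K μ (Fin d → K)) :
    toGTensor e K d (diagRep (Box μ) (natRep K d) g x) =
      gTensorRep K d (spechtRep K n μ) g (toGTensor e K d x) := by
  have h : (PiTensorProduct.reindex K (fun _ : Box μ => Fin d → K) e).toLinearMap ∘ₗ
      diagRep (Box μ) (natRep K d) g = diagRep (Fin n) (natRep K d) g ∘ₗ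
        (PiTensorProduct.reindex K (fun _ : Box μ => Fin d → K) e).toLinearMap := by
    refine PiTensorProduct.ext (MultilinearMap.ext fun f => ?_)
    simp only [LinearMap.compMultilinearMap_apply, LinearMap.comp_apply, LinearEquiv.coe_coe,
      diagRep_tprod]
    refine (PiTensorProduct.reindex_tprod (R := K) (s := fun _ : Box μ => Fin d → K) e _).trans ?_
    refine Eq.trans ?_ (congrArg _ (PiTensorProduct.reindex_tprod (R := K)
      (s := fun _ : Box μ => Fin d → K) e f)).symm
    exact (diagRep_tprod _ _ _ _).symm
  have h' := LinearMap.congr_fun h x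
  simp only [LinearMap.comp_apply, LinearEquiv.coe_coe] at h'
  rw [toGTensor_apply, h']
  rfl

theorem fromGTensor_injective (e : Box μ ≃ Fin n) (h2 : (2 : K) ≠ 0) : Function.Injective (fromGTensor K n d μ) := by
  rw [← LinearMap.ker_eq_bot, eq_bot_iff]
  intro z hz
  obtain ⟨x, rfl⟩ := toGTensor_surjective e z
  rw [LinearMap.mem_ker, fromGTensor_toGTensor] at hz
  have hx : x ∈ (⊤ : Submodule K (TabSpace K μ (Fin d → K))) := Submodule.mem_top
  rw [← span_semistandard_sup_ker (Pi.basisFun K (Fin d)) h2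
    (fun _ ha => sum_smul_toGTensor_placePerm e ha)] at hx
  -- Here `y` is semistandard and `w` is killed by `toGTensor`, hence by the polytabloid map. So `y`
  -- has zero polytabloid, and independence gives `y = 0`.
  obtain ⟨y, hy, w, hw, rfl⟩ := Submodule.mem_sup.1 hx
  rw [LinearMap.mem_ker] at hw
  have hPw := fromGTensor_toGTensor e w
  rw [hw, map_zero] at hPw
  rw [map_add, ← hPw, add_zero] at hz
  rw [eq_zero_of_mem_span_semistandard _ hy hz, zero_add, hw]
  exact zero_mem _

theorem range_fromGTensor (e : Box μ ≃ Fin n) :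
    LinearMap.range (fromGTensor K n d μ) = nabla μ (Pi.basisFun K (Fin d)) := by
  have h : fromGTensor K n d μ ∘ₗ toGTensor e K d = polytabloid K μ (Fin d → K) :=
    LinearMap.ext (fromGTensor_toGTensor e)
  rw [nabla_eq_range, ← h, LinearMap.range_comp, LinearMap.range_eq_top.2 (toGTensor_surjective e),
    LinearMap.range_eq_map]

theorem fromGTensor_gTensorRep (e : Box μ ≃ Fin n) (g : GL (Fin d) K)
    (z : GTensor K d (spechtRep K n μ)) :
    fromGTensor K n d μ (gTensorRep K d (spechtRep K n μ) g z) =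
      rowTabloidsRep μ (natRep K d) g (fromGTensor K n d μ z) := by
  obtain ⟨x, rfl⟩ := toGTensor_surjective e z
  rw [← toGTensor_diagRep, fromGTensor_toGTensor, fromGTensor_toGTensor,
    rowTabloidsRep_polytabloid]

/-- The isomorphism `E^{⊗ n} ⊗_{K S_n} S^μ ≅ ∇^μ(E)`. -/
def gTensorSpechtEquiv (e : Box μ ≃ Fin n) (h2 : (2 : K) ≠ 0) :
    (gTensorRep K d (spechtRep K n μ)).Equiv (dualWeylRep K d μ) :=
  Representation.Equiv.mk
    ((LinearEquiv.ofInjective _ (fromGTensor_injective e h2)).trans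
      (LinearEquiv.ofEq _ _ (range_fromGTensor e)))
    fun g => LinearMap.ext fun z => Subtype.ext (fromGTensor_gTensorRep e g z)

end Numbering

end InverseSchur
end

theorem mainTheorem1 (K : Type*) [Field K] (hK : ringChar K ≠ 2) (n d : ℕ) (p : n.Partition) :
    Nonempty ((InverseSchur.gTensorRep K d (InverseSchur.spechtRep K n
      (InverseSchur.diagram p))).Equiv
        (InverseSchur.dualWeylRep K d (InverseSchur.diagram p))) :=
  ⟨InverseSchur.gTensorSpechtEquiv
    (Fintype.equivFinOfCardEq (InverseSchur.card_box_diagram p)) (Ring.two_ne_zero hK)⟩
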